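/- Let $q=2^n\ge 4$ and let $k=\mathbb F_{q^2}$. Let $Y_2=k(x,y)$, where $x$ is transcendental over $k$ and $y$ satisfies $$y^{q/2}+y^{q/4}+\dots+y^2+y=x^{q+1}.$$ Let $\infty$ denote the infinite place of $k(x)$ (the pole of $x$). For a finite Galois extension $E/F$ of function fields over $k$, a place $P$ of $F$ and a place $Q$ of $E$ lying over $P$, with valuation ring $\mathcal O_Q$ and normalized discrete valuation $\nu_Q$, let $$G_j(Q|P)=\{\sigma\in\mathrm{Gal}(E/F):\nu_Q(\sigma(z)-z)\ge j+1\text{ for all }z\in\mathcal O_Q\}\qquad(j\ge 0)$$ be the $j$-th higher ramification group, let $e(Q|P)$ and $d(Q|P)$ be the ramification index and the different exponent, and let $a(Q|P)$ be the least integer $a\ge 0$ such that $G_j(Q|P)$ is trivial for all $j\ge a$. If $E/F$ is abelian, its conductor is the divisor $\mathrm{Cond}(E/F)=\sum_P c_P(E/F)\,P$ of $F$, where $P$ runs over all places of $F$ and $c_P(E/F)=\dfrac{d(Q|P)+a(Q|P)}{e(Q|P)}$ for any place $Q$ of $E$ over $P$. Then $Y_2/k(x)$ is a finite abelian extension with conductor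 $$\mathrm{Cond}(Y_2/k(x))=(q+2)\cdot\infty.$$ Moreover, there is exactly one place $P_\infty$ of $Y_2$ over $\infty$, and $G_j(P_\infty|\infty)=\mathrm{Gal}(Y_2/k(x))$ for $0\le j\le q+1$, while $G_j(P_\infty|\infty)=\{\mathrm{id}\}$ for all $j\ge q+2$. -/

import Mathlib

namespace FunctionFieldPlaces

/-- A place of a function field `F / k`, given by its valuation ring `k ⊆ 𝒪 ⊊ F`. -/
structure Place (k F : Type*) [Field k] [Field F] [Algebra k F] where
  /-- The valuation ring `𝒪_P`. -/
  ring : ValuationSubring F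
  algebraMap_mem : ∀ a : k, algebraMap k F a ∈ ring
  ne_top : ring ≠ ⊤

/-- Divisors of `F / k`: finite formal integral sums of places. -/
abbrev Divisor (k F : Type*) [Field k] [Field F] [Algebra k F] : Type _ := Place k F →₀ ℤ

namespace Place

section Basic

variable {k F : Type*} [Field k] [Field F] [Algebra k F]

/-- The order of an element `z` of `𝒪_P` at `P`: the largest `m` such that `z` lies in the `m`-th
power of the maximal ideal (and `∞` if there is no largest one, that is, for `z = 0`). -/
noncomputable def ord (P : Place k F) (z : P.ring) : ℕ∞ :=
  ⨆ m : {m : ℕ // z ∈ IsLocalRing.maximalIdeal P.ring ^ m}, ((m : ℕ) : ℕ∞)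

open Classical in
/-- The normalized discrete valuation `ν_P : F → ℤ ∪ {∞}`; for `z ∉ 𝒪_P` one has `z⁻¹ ∈ 𝒪_P` and
`ν_P z = - ν_P (z⁻¹)`. -/
noncomputable def nu (P : Place k F) (z : F) : WithTop ℤ :=
  if h : z ∈ P.ring then (P.ord ⟨z, h⟩).map (Nat.cast : ℕ → ℤ)
  else ((-((P.ord ⟨z⁻¹, (P.ring.mem_or_inv_mem z).resolve_left h⟩).toNat : ℤ) : ℤ) : WithTop ℤ)

/-- `t` is a prime element of `P`: it generates the maximal ideal of `𝒪_P`. -/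
def IsPrimeElement (P : Place k F) (t : F) : Prop :=
  ∃ h : t ∈ P.ring, IsLocalRing.maximalIdeal P.ring = Ideal.span {(⟨t, h⟩ : P.ring)}

end Basic

section Extension

variable {k F E : Type*} [Field k] [Field F] [Field E] [Algebra k F] [Algebra k E] [Algebra F E]

/-- `Q | P`: the place `Q` of `E` lies over the place `P` of `F`, i.e. `𝒪_Q ∩ F = 𝒪_P`. -/
def LiesOver (Q : Place k E) (P : Place k F) : Prop :=
  Q.ring.comap (algebraMap F E) = P.ring

/-- The ramification index `e(Q|P) = ν_Q(t)`, where `t` is any prime element of `P`. -/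
noncomputable def ramificationIndex (Q : Place k E) (P : Place k F) : ℕ :=
  sInf {e : ℕ | ∃ t : F, P.IsPrimeElement t ∧ Q.nu (algebraMap F E t) = ((e : ℤ) : WithTop ℤ)}

variable (E) in
/-- The complementary module `{z ∈ E | Tr_{E/F}(z 𝒪') ⊆ 𝒪_P}` over `𝒪_P`, where `𝒪'` is the integral
closure of `𝒪_P` in `E`. -/
def complementaryModule (P : Place k F) : Set E :=
  {z : E | ∀ w ∈ integralClosure P.ring E, Algebra.trace F E (z * w) ∈ P.ring}

/-- The different exponent `d(Q|P) = - min {ν_Q(z) | z ∈ C_P}`, where `C_P` is the complementary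
module (so `C_P = t 𝒪'` gives `d(Q|P) = - ν_Q(t)`). -/
noncomputable def differentExponent (Q : Place k E) (P : Place k F) : ℤ :=
  sSup {d : ℤ | ∃ z ∈ P.complementaryModule E, Q.nu z = ((-d : ℤ) : WithTop ℤ)}

variable (F) in
/-- The `j`-th (lower numbering) higher ramification group of `Q` in `E / F`, as a subset of
`Gal(E/F)`: all `σ` with `ν_Q(σ z - z) ≥ j + 1` for every `z ∈ 𝒪_Q`. -/
def ramificationGroup (Q : Place k E) (j : ℕ) : Set (E ≃ₐ[F] E) :=
  {σ | ∀ z ∈ Q.ring, (((j : ℤ) + 1 : ℤ) : WithTop ℤ) ≤ Q.nu (σ z - z)}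

variable (F) in
/-- `a(Q|P)`: the least `a ≥ 0` such that the ramification groups `G_j` are trivial for `j ≥ a`. -/
noncomputable def ramificationBound (Q : Place k E) : ℕ :=
  sInf {a : ℕ | ∀ j : ℕ, a ≤ j → Q.ramificationGroup F j = {1}}

/-- The conductor exponent `(d(Q|P) + a(Q|P)) / e(Q|P)`, as a rational number. -/
noncomputable def conductorExponent (Q : Place k E) (P : Place k F) : ℚ :=
  ((Q.differentExponent P : ℚ) + (Q.ramificationBound F : ℚ)) / (Q.ramificationIndex P : ℚ)

end Extension

end Place

/-- `D` is the conductor of the abelian extension `E / F`: it is the divisor of `F` whose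
coefficient at each place `P` is the conductor exponent `c_P(E/F)`, computed at any of the (always
existing) places `Q` of `E` over `P`. -/
def IsConductor {k F : Type*} (E : Type*) [Field k] [Field F] [Field E] [Algebra k F] [Algebra k E]
    [Algebra F E] (D : Divisor k F) : Prop :=
  ∀ P : Place k F, (∃ Q : Place k E, Q.LiesOver P) ∧
    ∀ Q : Place k E, Q.LiesOver P → (D P : ℚ) = Q.conductorExponent P

open Classical in
/-- The infinite place of `k(x)`: its valuation ring consists of the rational functions whose
numerator has degree at most that of the denominator. -/
noncomputable def inftyPlace (k : Type*) [Field k] : Place k (RatFunc k) where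
  ring := (RatFunc.inftyValuation k).valuationSubring
  algebraMap_mem a := by
    rw [Valuation.mem_valuationSubring_iff]
    by_cases ha : a = 0
    · simp [ha]
    · exact (RatFunc.inftyValuation.C k ha).le
  ne_top h := by
    have hX : RatFunc.X ∈ (RatFunc.inftyValuation k).valuationSubring := h ▸ ValuationSubring.mem_top _
    rw [Valuation.mem_valuationSubring_iff, RatFunc.inftyValuation.X] at hX
    exact absurd hX (by decide)

/-- `L = k(x, y)` with `x` transcendental over `k` and
`y^{q/2} + y^{q/4} + ⋯ + y² + y = x^{q+1}`, where `q = 2 ^ n`. -/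
structure IsAbdonTorres (k : Type*) [Field k] (n : ℕ) {L : Type*} [Field L] [Algebra (RatFunc k) L]
    (y : L) : Prop where
  equation : ∑ i ∈ Finset.range n, y ^ 2 ^ i = algebraMap (RatFunc k) L RatFunc.X ^ (2 ^ n + 1)
  adjoin_eq_top : IntermediateField.adjoin (RatFunc k) {y} = ⊤

end FunctionFieldPlaces

/-!
Write `q = 2^n`, `m = q / 2` and `T = X^{q/2} + ⋯ + X² + X`, so that `T(y) = x^{q+1}`.

*The Galois group.* `T` is additive with derivative `1`, and it divides `X^{q²} - X`, so its roots are
`m` elements of `k`. The conjugates of `y` are therefore the elements `y + a` with `T(a) = 0`; the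
extension is Galois, and its automorphisms `y ↦ y + a` commute.

*Infinity.* Let `Q` be any place over `∞`, with absolute value `w`. Comparing leading terms in
`T(y) = x^{q+1}` gives `w(y)^m = w(x)^{q+1}`. With `t = x² / y` and `τ = w(t)` this says
`w(x) = τ^{-m}` and `w(y) = τ^{-(q+1)}`. As `q + 1` is prime to `m`, the nonzero terms of a sum
`∑_{j<m} f_j y^j` have distinct absolute values, so the largest of them is the absolute value of the
sum (`exists_valuation_aeval_eq`). This one fact carries the argument: it shows that `t` is a
uniformizer, that the valuation ring of `Q` is determined by the orders of the `f_j` (so `Q` is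
unique), and that `1, y, …, y^{m-1}` are linearly independent (so `T - x^{q+1}` is the minimal
polynomial of `y`, and the ramification is total). It also gives the ramification groups: an
automorphism `σ ≠ 1` moves `t` by an element of order exactly `q + 2`
(`valuation_apply_uniformizer_sub`), and every integral element by one of order at least `q + 2`
(`valuation_apply_sub_le`).

*The different.* The minimal polynomial has derivative `1`, so by Euler's formula for the dual of a
power basis the trace of `∑_{j<m} f_j y^j` is `f_{m-1}`. At infinity this gives the different
exponent `(m - 1)(q + 2)`, and the conductor exponent is
`((m - 1)(q + 2) + (q + 2)) / m = q + 2`. At every other place `x`, and hence `y`, is integral; the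
complementary module is then the integral closure, an automorphism `σ ≠ 1` moves `y` by a nonzero
constant, and both the different exponent and the ramification bound vanish.
-/

/-! ### Uniformizers, extension of places, and the complementary module -/

namespace FunctionFieldPlaces

namespace Place

section Valuation

variable {k F : Type*} [Field k] [Field F] [Algebra k F] (P : Place k F)

@[ext]
theorem ext_ring {P Q : Place k F} (h : P.ring = Q.ring) : P = Q := by
  cases P; cases Q; congr

theorem valuation_algebraMap {a : k} (ha : a ≠ 0) : P.ring.valuation (algebraMap k F a) = 1 := by
  refine le_antisymm ((P.ring.valuation_le_one_iff _).2 (P.algebraMap_mem a)) ?_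
  have h := (P.ring.valuation_le_one_iff _).2 (P.algebraMap_mem a⁻¹)
  rwa [map_inv₀, map_inv₀, inv_le_one₀] at h
  rw [zero_lt_iff]
  simpa using ha

instance : P.ring.valuation.IsTrivialOn k := ⟨fun _ h => P.valuation_algebraMap h⟩

theorem ord_zero : P.ord 0 = ⊤ := by
  rw [ord, ENat.eq_top_iff_forall_ge]
  intro m
  exact le_iSup (fun m : {m : ℕ // (0 : P.ring) ∈ IsLocalRing.maximalIdeal P.ring ^ m} =>
    ((m : ℕ) : ℕ∞)) ⟨m, Ideal.zero_mem _⟩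

theorem nu_zero : P.nu 0 = ⊤ := by
  rw [nu, dif_pos P.ring.zero_mem]
  change (P.ord 0).map _ = _
  rw [ord_zero]
  rfl

theorem nu_nonneg {z : F} (hz : z ∈ P.ring) : 0 ≤ P.nu z := by
  rw [nu, dif_pos hz]
  generalize P.ord ⟨z, hz⟩ = a
  induction a using ENat.recTopCoe with
  | top => exact le_top
  | coe a => exact WithTop.coe_le_coe.2 (Int.natCast_nonneg a)

theorem ord_eq_zero_of_isUnit {z : P.ring} (hz : IsUnit z) : P.ord z = 0 := by
  rw [ord, ENat.iSup_eq_zero]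
  rintro ⟨m, hm⟩
  by_contra h
  have hm0 : m ≠ 0 := by simpa using h
  exact (IsLocalRing.mem_maximalIdeal z).1 (Ideal.pow_le_self hm0 hm) hz

theorem nu_eq_zero {z : F} (hz : P.ring.valuation z = 1) : P.nu z = 0 := by
  have h : z ∈ P.ring := (P.ring.valuation_le_one_iff _).1 hz.le
  rw [nu, dif_pos h, ord_eq_zero_of_isUnit P ((P.ring.valuation_eq_one_iff ⟨z, h⟩).2 hz)]
  rfl

/-- `t` is a uniformizer of `P` in the valuation-theoretic sense: `0 < |t| < 1`, and every nonzero
absolute value is an integral power of `|t|`. In particular `𝒪_P` is a discrete valuation ring. -/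
structure IsUniformizer (t : F) : Prop where
  pos : 0 < P.ring.valuation t
  lt_one : P.ring.valuation t < 1
  exists_zpow : ∀ z : F, z ≠ 0 → ∃ i : ℤ, P.ring.valuation z = P.ring.valuation t ^ i

namespace IsUniformizer

variable {P} {t : F} (ht : P.IsUniformizer t)

include ht

theorem zpow_le_iff {i j : ℤ} :
    P.ring.valuation t ^ i ≤ P.ring.valuation t ^ j ↔ j ≤ i :=
  zpow_le_zpow_iff_right_of_lt_one₀ ht.pos ht.lt_one

theorem zpow_lt_iff {i j : ℤ} :
    P.ring.valuation t ^ i < P.ring.valuation t ^ j ↔ j < i :=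
  zpow_lt_zpow_iff_right_of_lt_one₀ ht.pos ht.lt_one

theorem zpow_inj {i j : ℤ} :
    P.ring.valuation t ^ i = P.ring.valuation t ^ j ↔ i = j := by
  rw [le_antisymm_iff, ht.zpow_le_iff, ht.zpow_le_iff, and_comm, ← le_antisymm_iff]

theorem mem : t ∈ P.ring := (P.ring.valuation_le_one_iff _).1 ht.lt_one.le

theorem maximalIdeal_eq : IsLocalRing.maximalIdeal P.ring = Ideal.span {⟨t, ht.mem⟩} := by
  ext a
  rw [P.ring.valuation_lt_one_iff, Ideal.mem_span_singleton']
  constructor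
  · intro h
    by_cases ha : (a : F) = 0
    · exact ⟨0, Subtype.ext (by simpa using ha.symm)⟩
    · obtain ⟨i, hi⟩ := ht.exists_zpow _ ha
      have hi1 : (0 : ℤ) < i := by
        rwa [hi, ← zpow_zero (P.ring.valuation t), ht.zpow_lt_iff] at h
      have : P.ring.valuation (a : F) ≤ P.ring.valuation t := by
        conv_rhs => rw [← zpow_one (P.ring.valuation t)]
        rw [hi, ht.zpow_le_iff]
        omega
      obtain ⟨b, hb⟩ := (P.ring.valuation_le_iff _ _).1 this
      exact ⟨b, Subtype.ext hb⟩
  · rintro ⟨b, rfl⟩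
    change P.ring.valuation (b * t) < 1
    rw [map_mul]
    exact (mul_le_of_le_one_left' (P.ring.valuation_le_one b)).trans_lt ht.lt_one

theorem mem_maximalIdeal_pow {z : P.ring} {m : ℕ} :
    z ∈ IsLocalRing.maximalIdeal P.ring ^ m ↔
      P.ring.valuation (z : F) ≤ P.ring.valuation t ^ m := by
  rw [ht.maximalIdeal_eq, Ideal.span_singleton_pow, Ideal.mem_span_singleton', ← map_pow,
    P.ring.valuation_le_iff]
  simp [Subtype.ext_iff]

theorem ord_eq {z : P.ring} {m : ℕ} (hz : P.ring.valuation (z : F) = P.ring.valuation t ^ m) :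
    P.ord z = m := by
  have key (i : ℕ) : z ∈ IsLocalRing.maximalIdeal P.ring ^ i ↔ i ≤ m := by
    rw [ht.mem_maximalIdeal_pow, hz, ← zpow_natCast, ← zpow_natCast, ht.zpow_le_iff, Nat.cast_le]
  refine le_antisymm (iSup_le fun i => Nat.cast_le.2 ((key _).1 i.2)) ?_
  exact le_iSup (fun i : {i : ℕ // z ∈ IsLocalRing.maximalIdeal P.ring ^ i} =>
    ((i : ℕ) : ℕ∞)) ⟨m, (key m).2 le_rfl⟩

theorem nu_eq {z : F} {i : ℤ} (hz : P.ring.valuation z = P.ring.valuation t ^ i) :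
    P.nu z = i := by
  by_cases h : z ∈ P.ring
  · have hi : 0 ≤ i := by
      rwa [← P.ring.valuation_le_one_iff, hz, ← zpow_zero (P.ring.valuation t),
        ht.zpow_le_iff] at h
    lift i to ℕ using hi
    rw [nu, dif_pos h, ht.ord_eq (m := i) (by simpa using hz)]
    rfl
  · have hi : i < 0 := by
      rwa [← P.ring.valuation_le_one_iff, hz, ← zpow_zero (P.ring.valuation t),
        ht.zpow_le_iff, not_le] at h
    obtain ⟨j, rfl⟩ : ∃ j : ℕ, i = -j := ⟨i.natAbs, by omega⟩
    rw [nu, dif_neg h, ht.ord_eq (m := j) (by simp [hz])]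
    simp

theorem le_nu_iff {z : F} {i : ℤ} :
    (i : WithTop ℤ) ≤ P.nu z ↔ P.ring.valuation z ≤ P.ring.valuation t ^ i := by
  by_cases hz : z = 0
  · simp [hz, nu_zero]
  · obtain ⟨j, hj⟩ := ht.exists_zpow z hz
    rw [ht.nu_eq hj, hj, ht.zpow_le_iff, WithTop.coe_le_coe]

end IsUniformizer

end Valuation

section Extension

variable {k F E : Type*} [Field k] [Field F] [Field E] [Algebra k F] [Algebra k E] [Algebra F E]

theorem LiesOver.mem_iff {Q : Place k E} {P : Place k F} (h : Q.LiesOver P) {f : F} :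
    algebraMap F E f ∈ Q.ring ↔ f ∈ P.ring := by
  rw [← h]; rfl

/-- The local subring `𝒪_P` of `E` is dominated by a valuation ring of `E`, whose trace on `F` is
`𝒪_P` again, because a valuation ring is maximal for domination. -/
theorem exists_liesOver [IsScalarTower k F E] (P : Place k F) : ∃ Q : Place k E, Q.LiesOver P := by
  obtain ⟨B, hB1, hB2⟩ :=
    ((P.ring.toLocalSubring).map (algebraMap F E)).exists_le_valuationSubring
  have hle : P.ring ≤ B.comap (algebraMap F E) := fun f hf =>
    hB1 (Subring.mem_map.2 ⟨f, hf, rfl⟩)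
  have hcomap : B.comap (algebraMap F E) = P.ring := by
    refine le_antisymm (fun f hf => ?_) hle
    by_contra hfP
    have hf0 : f ≠ 0 := fun h => hfP (h ▸ P.ring.zero_mem)
    have hfi : f⁻¹ ∈ P.ring := (P.ring.mem_or_inv_mem f).resolve_left hfP
    have hmem : algebraMap F E f⁻¹ ∈ ((P.ring.toLocalSubring).map (algebraMap F E)).toSubring :=
      Subring.mem_map.2 ⟨_, hfi, rfl⟩
    have hunit : IsUnit (Subring.inclusion hB1 ⟨_, hmem⟩) := by
      refine IsUnit.of_mul_eq_one (⟨algebraMap F E f, hf⟩ : B.toLocalSubring.toSubring)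
        (Subtype.ext ?_)
      change algebraMap F E f⁻¹ * algebraMap F E f = 1
      rw [← map_mul, inv_mul_cancel₀ hf0, map_one]
    obtain ⟨⟨b, hb⟩, hb'⟩ := isUnit_iff_exists_inv.1 (hB2.map_nonunit _ hunit)
    obtain ⟨g, hg, rfl⟩ := Subring.mem_map.1 hb
    have : algebraMap F E f⁻¹ * algebraMap F E g = 1 := congrArg Subtype.val hb'
    rw [← map_mul, ← map_one (algebraMap F E)] at this
    have h2 := (algebraMap F E).injective this
    have : g = f := by
      rw [inv_mul_eq_one₀ hf0] at h2; exact h2.symm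
    exact hfP (this ▸ hg)
  refine ⟨⟨B, fun a => ?_, fun h => P.ne_top ?_⟩, hcomap⟩
  · rw [IsScalarTower.algebraMap_apply k F E]
    exact hle (P.algebraMap_mem a)
  · rw [← hcomap, h]; rfl

theorem LiesOver.mem_of_isIntegral {Q : Place k E} {P : Place k F} (h : Q.LiesOver P) {z : E}
    (hz : IsIntegral P.ring z) : z ∈ Q.ring := by
  obtain ⟨p, hp, hpz⟩ := hz
  let φ : P.ring →+* Q.ring :=
    ((algebraMap F E).comp P.ring.subtype).codRestrict Q.ring.toSubring
      (fun a => h.mem_iff.2 a.2)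
  have : IsIntegral Q.ring z := by
    refine ⟨p.map φ, hp.map _, ?_⟩
    rw [Polynomial.eval₂_map]
    exact hpz
  obtain ⟨w, hw⟩ := IsIntegrallyClosed.isIntegral_iff.1 this
  exact hw ▸ w.2

theorem LiesOver.valuation_eq_one {Q : Place k E} {P : Place k F} (h : Q.LiesOver P) {f : F}
    (hf : P.ring.valuation f = 1) : Q.ring.valuation (algebraMap F E f) = 1 := by
  refine le_antisymm ?_ ?_
  · rw [Q.ring.valuation_le_one_iff, h.mem_iff, ← P.ring.valuation_le_one_iff, hf]
  · have hf0 : f ≠ 0 := by rintro rfl; simp at hf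
    rw [← inv_le_one₀ (by simpa [zero_lt_iff] using hf0), ← map_inv₀, ← map_inv₀,
      Q.ring.valuation_le_one_iff, h.mem_iff, ← P.ring.valuation_le_one_iff, map_inv₀, hf, inv_one]

/-- Any two prime elements differ by a unit, so the ramification index can be read off from a single
prime element `s` of `P` and a uniformizer `t` of `Q`. -/
theorem LiesOver.ramificationIndex_eq {Q : Place k E} {P : Place k F} (h : Q.LiesOver P) {s : F}
    {t : E} (hs : P.IsPrimeElement s) (ht : Q.IsUniformizer t) {e : ℕ}
    (hst : Q.ring.valuation (algebraMap F E s) = Q.ring.valuation t ^ e) :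
    Q.ramificationIndex P = e := by
  have key (r : F) (hr : P.IsPrimeElement r) : Q.nu (algebraMap F E r) = ((e : ℤ) : WithTop ℤ) := by
    obtain ⟨hs, hs'⟩ := hs
    obtain ⟨hr, hr'⟩ := hr
    obtain ⟨u, hu⟩ := Ideal.span_singleton_eq_span_singleton.1 (hs'.symm.trans hr')
    have hu' : s * ((u : P.ring) : F) = r := congrArg Subtype.val hu
    refine ht.nu_eq ?_
    rw [← hu', map_mul, map_mul,
      h.valuation_eq_one ((P.ring.valuation_eq_one_iff (u : P.ring)).1 u.isUnit), mul_one, hst,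
      zpow_natCast]
  have : {e : ℕ | ∃ r : F, P.IsPrimeElement r ∧
      Q.nu (algebraMap F E r) = ((e : ℤ) : WithTop ℤ)} = {e} := by
    ext e'
    constructor
    · rintro ⟨r, hr, he'⟩
      rw [key r hr] at he'
      exact_mod_cast he'.symm
    · rintro rfl
      exact ⟨s, hs, key s hs⟩
  rw [ramificationIndex, this, csInf_singleton]

end Extension

section Different

variable {k F E : Type*} [Field k] [Field F] [Field E] [Algebra k F] [Algebra F E]

open Polynomial in
/-- Euler's description of the dual of a power basis: if `y` is integral over `𝒪_P` and generates
`E / F`, the complementary module is contained in `f'(y)⁻¹ 𝒪'`, where `f` is the minimal polynomial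
of `y`. -/
theorem isIntegral_mul_of_mem_complementaryModule [FiniteDimensional F E] [Algebra.IsSeparable F E]
    {P : Place k F} {y : E} (hy : IsIntegral P.ring y) (hgen : Algebra.adjoin F {y} = ⊤) {z : E}
    (hz : z ∈ P.complementaryModule E) :
    IsIntegral P.ring (z * aeval y (derivative (minpoly F y))) := by
  set pb := PowerBasis.ofAdjoinEqTop (IsIntegral.of_finite F y) hgen
  have hpb : pb.gen = y := PowerBasis.ofAdjoinEqTop_gen _ _
  have hne : aeval y (derivative (minpoly F y)) ≠ 0 :=
    (Algebra.IsSeparable.isSeparable F y).aeval_derivative_ne_zero (minpoly.aeval F y)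
  rw [← pb.basis.traceDual.sum_repr z, Finset.sum_mul]
  refine IsIntegral.sum _ fun i _ => ?_
  rw [Module.Basis.traceDual_repr_apply, Module.Basis.traceDual_powerBasis_eq, hpb, smul_mul_assoc,
    div_mul_cancel₀ _ hne, Algebra.smul_def, Algebra.traceForm_apply, PowerBasis.coe_basis, hpb]
  refine IsIntegral.mul ?_ ?_
  · exact isIntegral_algebraMap (A := E) (R := P.ring)
      (x := ⟨_, hz (y ^ (i : ℕ)) (hy.pow _)⟩)
  · rw [← minpolyDiv_eq_of_isIntegrallyClosed (R := P.ring) (K := F) hy]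
    have := Algebra.IsIntegral.adjoin (R := P.ring) (A := E) (S := {y}) (by simpa using hy)
    have h2 := coeff_minpolyDiv_mem_adjoin (R := P.ring) y (i : ℕ)
    exact (this.isIntegral ⟨_, h2⟩).map (Algebra.adjoin P.ring {y}).val

open Polynomial in
/-- The coefficient of `X^{d-1}` in `f(X) / (X - y)` is `1`, so by Euler's formula `1 / f'(y)` is the
element of the dual basis belonging to `y^{d-1}`, where `d = deg f`. -/
theorem trace_aeval_eq_coeff [FiniteDimensional F E] [Algebra.IsSeparable F E]
    {y : E} (hgen : Algebra.adjoin F {y} = ⊤) (hder : aeval y (derivative (minpoly F y)) = 1)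
    {p : F[X]} (hp : p.natDegree < (minpoly F y).natDegree) :
    Algebra.trace F E (aeval y p) = p.coeff ((minpoly F y).natDegree - 1) := by
  have hy := IsIntegral.of_finite F y
  set d := (minpoly F y).natDegree with hd
  set pb := PowerBasis.ofAdjoinEqTop hy hgen
  have hpb : pb.gen = y := PowerBasis.ofAdjoinEqTop_gen _ _
  have hdim : pb.dim = d := PowerBasis.ofAdjoinEqTop_dim _ _
  have hd1 : d - 1 < d := by omega
  have hone : pb.basis.traceDual ⟨d - 1, hdim.symm ▸ hd1⟩ = 1 := by
    rw [Module.Basis.traceDual_powerBasis_eq, hpb, hder, div_one]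
    have h := natDegree_minpolyDiv_succ hy
    change (minpolyDiv F y).coeff (d - 1) = 1
    rw [show d - 1 = (minpolyDiv F y).natDegree by omega]
    exact minpolyDiv_monic hy
  have key (i : ℕ) (hi : i < d) :
      Algebra.trace F E (y ^ i) = if i = d - 1 then 1 else 0 := by
    have h := pb.basis.trace_traceDual_mul ⟨d - 1, hdim.symm ▸ hd1⟩ ⟨i, hdim.symm ▸ hi⟩
    rw [hone, one_mul, PowerBasis.coe_basis, hpb] at h
    simpa using h
  rw [aeval_eq_sum_range' hp, map_sum, Finset.sum_eq_single_of_mem (d - 1) (by simpa using hd1)]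
  · rw [map_smul, key _ hd1, if_pos rfl, smul_eq_mul, mul_one]
  · intro i hi hne
    rw [map_smul, key i (Finset.mem_range.1 hi), if_neg hne, smul_zero]

end Different

end Place

end FunctionFieldPlaces

/-! ### The trace polynomial -/

open Polynomial

namespace FunctionFieldPlaces

section TracePolynomial

/-- The additive polynomial `X + X² + X⁴ + ⋯ + X^{2^{n-1}}`. -/
noncomputable def tracePolynomial (R : Type*) [Semiring R] (n : ℕ) : R[X] :=
  ∑ i ∈ Finset.range n, X ^ 2 ^ i

variable {R : Type*} [CommRing R]

theorem eval_tracePolynomial (n : ℕ) (a : R) :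
    (tracePolynomial R n).eval a = ∑ i ∈ Finset.range n, a ^ 2 ^ i := by
  simp [tracePolynomial, eval_finsetSum]

theorem map_tracePolynomial {S : Type*} [CommRing S] (φ : R →+* S) (n : ℕ) :
    (tracePolynomial R n).map φ = tracePolynomial S n := by
  simp [tracePolynomial, Polynomial.map_sum]

theorem tracePolynomial_comp_sub [CharP R 2] (n : ℕ) (a : R) :
    (tracePolynomial R n).comp (X - C a) =
      tracePolynomial R n - C ((tracePolynomial R n).eval a) := by
  simp [tracePolynomial, eval_finsetSum, sum_comp, sub_pow_char_pow, Finset.sum_sub_distrib]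

theorem eval_sub_tracePolynomial [CharP R 2] (n : ℕ) (a b : R) :
    (tracePolynomial R n).eval (a - b) =
      (tracePolynomial R n).eval a - (tracePolynomial R n).eval b := by
  simp [eval_tracePolynomial, sub_pow_char_pow, Finset.sum_sub_distrib]

theorem derivative_tracePolynomial [CharP R 2] {n : ℕ} (hn : n ≠ 0) :
    derivative (tracePolynomial R n) = 1 := by
  obtain ⟨n, rfl⟩ := Nat.exists_eq_succ_of_ne_zero hn
  have h2 : (2 : R) = 0 := CharTwo.two_eq_zero
  rw [tracePolynomial, Finset.sum_range_succ', derivative_add, derivative_sum,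
    Finset.sum_eq_zero fun i _ => by rw [derivative_X_pow, pow_succ, Nat.cast_mul,
      Nat.cast_two, h2, mul_zero, C_0, zero_mul]]
  simp

theorem tracePolynomial_succ (n : ℕ) :
    tracePolynomial R (n + 1) = X ^ 2 ^ n + tracePolynomial R n := by
  rw [tracePolynomial, Finset.sum_range_succ, add_comm]; rfl

theorem degree_tracePolynomial_lt [Nontrivial R] (n : ℕ) :
    (tracePolynomial R n).degree < ((2 ^ n : ℕ) : WithBot ℕ) := by
  rw [tracePolynomial, ← mem_degreeLT]
  refine Submodule.sum_mem _ fun i hi => mem_degreeLT.2 ?_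
  rw [degree_X_pow]
  exact_mod_cast Nat.pow_lt_pow_right one_lt_two (Finset.mem_range.1 hi)

/-- Over `𝔽₂`, the trace polynomial satisfies `T² + T = X^{2^n} + X`; since `X^{2^n} + X` is
additive, iterating it shows that `T` divides `X^{q²} - X` for `q = 2^n`. -/
theorem tracePolynomial_dvd [CharP R 2] (n : ℕ) :
    tracePolynomial R n ∣ X ^ (2 ^ n) ^ 2 - X := by
  have h1 : tracePolynomial R n ^ 2 + tracePolynomial R n = X ^ 2 ^ n + X := by
    induction n with
    | zero => simp [tracePolynomial, CharTwo.add_self_eq_zero]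
    | succ n ih =>
      have h : (X ^ 2 ^ n : R[X]) + X ^ 2 ^ n = 0 := CharTwo.add_self_eq_zero _
      rw [tracePolynomial_succ, CharTwo.add_sq, ← pow_mul, ← pow_succ]
      linear_combination ih + h
  have h2 : (X ^ (2 ^ n) ^ 2 - X : R[X]) = (X ^ 2 ^ n + X) ^ 2 ^ n + (X ^ 2 ^ n + X) := by
    have h : (X ^ 2 ^ n : R[X]) + X ^ 2 ^ n = 0 := CharTwo.add_self_eq_zero _
    have h' : (X : R[X]) + X = 0 := CharTwo.add_self_eq_zero _
    rw [add_pow_char_pow, sq (2 ^ n), pow_mul]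
    linear_combination -h - h'
  rw [h2, ← h1]
  have h3 : tracePolynomial R n ∣ tracePolynomial R n ^ 2 + tracePolynomial R n :=
    dvd_add (dvd_pow_self _ two_ne_zero) dvd_rfl
  exact dvd_add (h3.trans (dvd_pow_self _ (by positivity))) h3

theorem splits_tracePolynomial {k : Type*} [Field k] [Finite k] [CharP k 2] {n : ℕ}
    (hk : Nat.card k = (2 ^ n) ^ 2) : (tracePolynomial k n).Splits := by
  have := Fintype.ofFinite k
  have h1 : 1 < Fintype.card k := Fintype.one_lt_card
  refine Splits.of_dvd (g := X ^ Fintype.card k - X) ?_ (FiniteField.X_pow_card_sub_X_ne_zero k h1)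
    ?_
  · rw [splits_iff_card_roots, FiniteField.roots_X_pow_card_sub_X,
      FiniteField.X_pow_card_sub_X_natDegree_eq k h1]
    rfl
  · rw [← Nat.card_eq_fintype_card, hk]
    exact tracePolynomial_dvd n

end TracePolynomial

end FunctionFieldPlaces

/-! ### The extension `k(x, y) / k(x)` is abelian -/

namespace FunctionFieldPlaces

namespace IsAbdonTorres

section Galois

variable {k : Type*} [Field k] {L : Type*} [Field L] [Algebra (RatFunc k) L] {r : ℕ} {y : L}

/-- The polynomial `T - x^{q+1}` over `k(x)` of which `y` is a root; here `T` is the trace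
polynomial and `q = 2^n`. -/
noncomputable def definingPolynomial (k : Type*) [Field k] (n : ℕ) : (RatFunc k)[X] :=
  tracePolynomial (RatFunc k) n - C (RatFunc.X ^ (2 ^ n + 1))

theorem definingPolynomial_eq (k : Type*) [Field k] (r : ℕ) :
    definingPolynomial k (r + 1) = X ^ 2 ^ r +
      (tracePolynomial (RatFunc k) r - C (RatFunc.X ^ (2 ^ (r + 1) + 1))) := by
  rw [definingPolynomial, tracePolynomial_succ, add_sub_assoc]

theorem degree_definingPolynomial_tail_lt (k : Type*) [Field k] (r : ℕ) :
    (tracePolynomial (RatFunc k) r - C (RatFunc.X ^ (2 ^ (r + 1) + 1))).degree <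
      ((2 ^ r : ℕ) : WithBot ℕ) :=
  (degree_sub_le _ _).trans_lt (max_lt (degree_tracePolynomial_lt r)
    (degree_C_le.trans_lt (by exact_mod_cast Nat.two_pow_pos r)))

theorem monic_definingPolynomial (k : Type*) [Field k] (r : ℕ) :
    (definingPolynomial k (r + 1)).Monic := by
  rw [definingPolynomial_eq]
  exact monic_X_pow_add (degree_definingPolynomial_tail_lt k r)

theorem natDegree_definingPolynomial (k : Type*) [Field k] (r : ℕ) :
    (definingPolynomial k (r + 1)).natDegree = 2 ^ r := by
  rw [definingPolynomial_eq]
  refine natDegree_eq_of_degree_eq_some ?_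
  rw [degree_add_eq_left_of_degree_lt] <;> rw [degree_X_pow]
  exact degree_definingPolynomial_tail_lt k r

theorem charP_ratFunc [CharP k 2] : CharP (RatFunc k) 2 :=
  charP_of_injective_algebraMap (algebraMap k (RatFunc k)).injective 2

theorem derivative_definingPolynomial [CharP (RatFunc k) 2] :
    derivative (definingPolynomial k (r + 1)) = 1 := by
  rw [definingPolynomial, derivative_sub, derivative_tracePolynomial r.succ_ne_zero, derivative_C,
    sub_zero]

theorem separable_definingPolynomial [CharP (RatFunc k) 2] :
    (definingPolynomial k (r + 1)).Separable := by
  rw [separable_def, derivative_definingPolynomial]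
  exact isCoprime_one_right

variable (hy : IsAbdonTorres k (r + 1) y)

include hy

theorem eval_tracePolynomial_eq :
    (tracePolynomial L (r + 1)).eval y = algebraMap (RatFunc k) L RatFunc.X ^ (2 ^ (r + 1) + 1) := by
  rw [eval_tracePolynomial, hy.equation]

theorem aeval_definingPolynomial : aeval y (definingPolynomial k (r + 1)) = 0 := by
  rw [definingPolynomial, map_sub, aeval_C, aeval_def, eval₂_eq_eval_map, map_tracePolynomial,
    hy.eval_tracePolynomial_eq, map_pow, sub_self]

theorem isIntegral : IsIntegral (RatFunc k) y :=
  ⟨_, monic_definingPolynomial k r, hy.aeval_definingPolynomial⟩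

theorem algebra_adjoin_eq_top : Algebra.adjoin (RatFunc k) {y} = ⊤ := by
  rw [← IntermediateField.adjoin_simple_toSubalgebra_of_isAlgebraic hy.isIntegral.isAlgebraic,
    hy.adjoin_eq_top, IntermediateField.top_toSubalgebra]

theorem finiteDimensional : FiniteDimensional (RatFunc k) L :=
  (PowerBasis.ofAdjoinEqTop hy.isIntegral hy.algebra_adjoin_eq_top).finite

/-- Every element of `k(x, y)` is a polynomial in `y` of degree less than `q / 2`. -/
theorem exists_aeval_eq (z : L) : ∃ p : (RatFunc k)[X], p.natDegree < 2 ^ r ∧ aeval y p = z := by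
  have hz : z ∈ Algebra.adjoin (RatFunc k) {y} := hy.algebra_adjoin_eq_top ▸ Algebra.mem_top
  obtain ⟨p, rfl⟩ := (Algebra.adjoin_singleton_eq_range_aeval (RatFunc k) y ▸ hz :)
  refine ⟨p %ₘ definingPolynomial k (r + 1), ?_, ?_⟩
  · have := natDegree_modByMonic_lt p (monic_definingPolynomial k r) (fun h => ?_)
    · rwa [natDegree_definingPolynomial] at this
    · have h2 := natDegree_definingPolynomial k r
      rw [h, natDegree_one] at h2
      exact (Nat.two_pow_pos r).ne h2
  · exact aeval_modByMonic_eq_self_of_root hy.aeval_definingPolynomial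

theorem algEquiv_ext {σ τ : L ≃ₐ[RatFunc k] L} (h : σ y = τ y) : σ = τ := by
  have : (σ : L →ₐ[RatFunc k] L) = τ :=
    AlgHom.ext_of_adjoin_eq_top hy.algebra_adjoin_eq_top (by simpa using h)
  exact AlgEquiv.ext fun z => DFunLike.congr_fun this z

variable [Algebra k L] [Finite k] [CharP k 2]
  (hk : Nat.card k = (2 ^ (r + 1)) ^ 2)

include hk

/-- The roots of `T` lie in `k`, so the conjugates of `y` are the elements `y + a` with
`T(a) = 0`. -/
theorem exists_apply_eq (σ : L ≃ₐ[RatFunc k] L) : ∃ a : k, σ y = y + algebraMap k L a := by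
  have : CharP L 2 := charP_of_injective_algebraMap (algebraMap k L).injective 2
  have h : (tracePolynomial L (r + 1)).IsRoot (σ y - y) := by
    rw [IsRoot, eval_sub_tracePolynomial, sub_eq_zero, hy.eval_tracePolynomial_eq]
    have := congrArg σ hy.eval_tracePolynomial_eq
    rw [map_pow, σ.commutes] at this
    rw [← this, eval_tracePolynomial, eval_tracePolynomial, map_sum]
    simp
  rw [← map_tracePolynomial (algebraMap k L)] at h
  have hT : tracePolynomial k (r + 1) ≠ 0 := fun h0 => by
    have := derivative_tracePolynomial (R := k) r.succ_ne_zero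
    simp [h0] at this
  obtain ⟨a, ha⟩ := (splits_tracePolynomial hk).mem_range_of_isRoot hT h
  exact ⟨a, by rw [ha]; ring⟩

theorem isGalois : IsGalois (RatFunc k) L := by
  have : CharP L 2 := charP_of_injective_algebraMap (algebraMap k L).injective 2
  have : CharP (RatFunc k) 2 := charP_ratFunc
  have hfin := hy.finiteDimensional
  have hroot : y ∈ (definingPolynomial k (r + 1)).rootSet L :=
    (mem_rootSet_of_ne (monic_definingPolynomial k r).ne_zero).2 hy.aeval_definingPolynomial
  have : (definingPolynomial k (r + 1)).IsSplittingField (RatFunc k) L := by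
    refine ⟨?_, ?_⟩
    · rw [definingPolynomial, Polynomial.map_sub, map_C, map_tracePolynomial, map_pow,
        ← hy.eval_tracePolynomial_eq, ← tracePolynomial_comp_sub,
        ← map_tracePolynomial (algebraMap k L)]
      exact ((splits_tracePolynomial hk).map _).comp_X_sub_C y
    · rw [eq_top_iff, ← hy.algebra_adjoin_eq_top]
      exact Algebra.adjoin_mono (by simpa using hroot)
  exact IsGalois.of_separable_splitting_field (p := definingPolynomial k (r + 1))
    separable_definingPolynomial

variable [IsScalarTower k (RatFunc k) L]

theorem isAbelianGalois : IsAbelianGalois (RatFunc k) L where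
  toIsGalois := hy.isGalois hk
  is_comm := ⟨fun σ τ => by
    have hfix (ρ : L ≃ₐ[RatFunc k] L) (a : k) : ρ (algebraMap k L a) = algebraMap k L a := by
      rw [IsScalarTower.algebraMap_apply k (RatFunc k) L, ρ.commutes]
    obtain ⟨a, ha⟩ := hy.exists_apply_eq hk σ
    obtain ⟨b, hb⟩ := hy.exists_apply_eq hk τ
    refine hy.algEquiv_ext ?_
    rw [AlgEquiv.mul_apply, AlgEquiv.mul_apply, ha, hb, map_add, map_add, ha, hb, hfix, hfix]
    ring⟩

end Galois

end IsAbdonTorres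

end FunctionFieldPlaces

/-! ### Orders at infinity -/

namespace FunctionFieldPlaces

/-- If the nonzero terms of a finite sum have pairwise distinct valuations, the valuation of the sum
is the maximum of the valuations of its terms. -/
theorem exists_valuation_sum_eq {R Γ ι : Type*} [Ring R] [LinearOrderedCommGroupWithZero Γ]
    (v : Valuation R Γ) {s : Finset ι} (hs : s.Nonempty) (f : ι → R)
    (hf : ∀ i ∈ s, ∀ j ∈ s, v (f i) ≠ 0 → v (f i) = v (f j) → i = j) :
    ∃ j ∈ s, v (∑ i ∈ s, f i) = v (f j) ∧ ∀ i ∈ s, v (f i) ≤ v (f j) := by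
  classical
  obtain ⟨j, hj, hmax⟩ := s.exists_max_image (fun i => v (f i)) hs
  refine ⟨j, hj, ?_, hmax⟩
  by_cases h0 : v (f j) = 0
  · rw [h0]
    exact le_antisymm (v.map_sum_le fun i hi => (hmax i hi).trans h0.le) zero_le
  · refine v.map_sum_eq_of_lt hj fun i hi => ?_
    obtain ⟨hi, hij⟩ := Finset.mem_sdiff.1 hi
    refine lt_of_le_of_ne (hmax i hi) fun h => hij ?_
    exact Finset.mem_singleton.2 (hf i hi j hj (h ▸ h0) h)

section RationalFunctionField

variable {k : Type*} [Field k]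

theorem Place.one_lt_valuation_X {P : Place k (RatFunc k)} (hP : RatFunc.X ∉ P.ring) :
    1 < P.ring.valuation RatFunc.X := by
  rwa [← not_le, P.ring.valuation_le_one_iff]

/-- A place of `k(x)` at which `x` has a pole is determined by the degree. -/
theorem Place.mem_ring_iff {P : Place k (RatFunc k)} (hP : RatFunc.X ∉ P.ring) {f : RatFunc k} :
    f ∈ P.ring ↔ f = 0 ∨ f.intDegree ≤ 0 := by
  by_cases hf : f = 0
  · simp [hf, P.ring.zero_mem]
  · have h1 := Place.one_lt_valuation_X hP
    rw [← P.ring.valuation_le_one_iff,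
      RatFunc.valuation_eq_valuation_X_zpow_intDegree_of_one_lt_valuation_X h1 hf,
      zpow_le_one_iff_right₀ h1, or_iff_right hf]

open Classical in
theorem X_notMem_inftyPlace : RatFunc.X ∉ (inftyPlace k).ring := by
  intro h
  change RatFunc.X ∈ (RatFunc.inftyValuation k).valuationSubring at h
  rw [Valuation.mem_valuationSubring_iff, RatFunc.inftyValuation.X] at h
  exact absurd h (by decide)

theorem mem_inftyPlace {f : RatFunc k} : f ∈ (inftyPlace k).ring ↔ f = 0 ∨ f.intDegree ≤ 0 :=
  Place.mem_ring_iff X_notMem_inftyPlace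

theorem X_mem_of_ne_inftyPlace {P : Place k (RatFunc k)} (hP : P ≠ inftyPlace k) :
    RatFunc.X ∈ P.ring := by
  by_contra h
  exact hP (Place.ext_ring (ValuationSubring.ext _ _ fun f => by
    rw [Place.mem_ring_iff h, mem_inftyPlace]))

theorem isUniformizer_inftyPlace :
    (inftyPlace k).IsUniformizer (RatFunc.X : RatFunc k)⁻¹ := by
  have h1 := Place.one_lt_valuation_X (X_notMem_inftyPlace (k := k))
  have h0 := zero_lt_one.trans h1
  refine ⟨?_, ?_, fun f hf => ⟨-f.intDegree, ?_⟩⟩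
  · rwa [map_inv₀, inv_pos]
  · rw [map_inv₀]; exact inv_lt_one_of_one_lt₀ h1
  · rw [RatFunc.valuation_eq_valuation_X_zpow_intDegree_of_one_lt_valuation_X h1 hf, map_inv₀,
      inv_zpow', neg_neg]

theorem isPrimeElement_inftyPlace : (inftyPlace k).IsPrimeElement (RatFunc.X : RatFunc k)⁻¹ :=
  ⟨_, isUniformizer_inftyPlace.maximalIdeal_eq⟩

end RationalFunctionField

namespace IsAbdonTorres

/-- The elements `x^a y^j` with `0 ≤ j < m` have pairwise distinct orders at infinity. -/
theorem order_injective {m i j : ℕ} {a b : ℤ} (hi : i < m) (hj : j < m)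
    (h : m * a + (2 * m + 1) * i = m * b + (2 * m + 1) * j) : i = j ∧ a = b := by
  have h1 : (i : ℤ) - j = m * (b - a + 2 * j - 2 * i) := by linear_combination h
  have h2 : (i : ℤ) - j = 0 :=
    Int.eq_zero_of_abs_lt_dvd ⟨_, h1⟩ (abs_lt.2 ⟨by omega, by omega⟩)
  have h3 : i = j := by omega
  subst h3
  refine ⟨rfl, ?_⟩
  have hm : (m : ℤ) ≠ 0 := by omega
  exact mul_left_cancel₀ hm (by linear_combination h)

section Infinity

variable {k : Type*} [Field k] {L : Type*} [Field L] [Algebra k L] [Algebra (RatFunc k) L]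
  [IsScalarTower k (RatFunc k) L] {r : ℕ} {y : L}

/-- The element `x² / y`, which turns out to be a uniformizer at infinity. -/
noncomputable def uniformizer (k : Type*) [Field k] {L : Type*} [Field L] [Algebra (RatFunc k) L]
    (y : L) : L :=
  algebraMap (RatFunc k) L RatFunc.X ^ 2 / y

section Place

variable {Q : Place k L} (hQ : Q.LiesOver (inftyPlace k))

include hQ

omit [IsScalarTower k (RatFunc k) L] in
theorem one_lt_valuation_X : 1 < Q.ring.valuation (algebraMap (RatFunc k) L RatFunc.X) := by
  rw [← not_le, Q.ring.valuation_le_one_iff, hQ.mem_iff]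
  exact X_notMem_inftyPlace

theorem valuation_algebraMap {f : RatFunc k} (hf : f ≠ 0) :
    Q.ring.valuation (algebraMap (RatFunc k) L f) =
      Q.ring.valuation (algebraMap (RatFunc k) L RatFunc.X) ^ f.intDegree := by
  let v := Q.ring.valuation.comap (algebraMap (RatFunc k) L)
  have : v.IsTrivialOn k := ⟨fun a ha => by
    change Q.ring.valuation _ = 1
    rw [← IsScalarTower.algebraMap_apply, Q.valuation_algebraMap ha]⟩
  exact RatFunc.valuation_eq_valuation_X_zpow_intDegree_of_one_lt_valuation_X (v := v)
    (one_lt_valuation_X hQ) hf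

variable (hy : IsAbdonTorres k (r + 1) y)

include hy

omit [IsScalarTower k (RatFunc k) L] in
theorem one_lt_valuation : 1 < Q.ring.valuation y := by
  by_contra! h
  have h1 : Q.ring.valuation (∑ i ∈ Finset.range (r + 1), y ^ 2 ^ i) ≤ 1 :=
    Q.ring.valuation.map_sum_le fun i _ => by rw [map_pow]; exact pow_le_one' h _
  rw [hy.equation, map_pow] at h1
  exact h1.not_gt (one_lt_pow₀ (one_lt_valuation_X hQ) (by omega))

omit [IsScalarTower k (RatFunc k) L] in
/-- The leading term dominates in `y^{q/2} + ⋯ + y = x^{q+1}`. -/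
theorem valuation_pow_eq : Q.ring.valuation y ^ 2 ^ r =
    Q.ring.valuation (algebraMap (RatFunc k) L RatFunc.X) ^ (2 * 2 ^ r + 1) := by
  have h1 := one_lt_valuation hQ hy
  rw [← pow_succ', ← map_pow, ← map_pow, ← hy.equation]
  symm
  refine Q.ring.valuation.map_sum_eq_of_lt (Finset.self_mem_range_succ r) fun i hi => ?_
  simp only [Finset.mem_sdiff, Finset.mem_range, Finset.mem_singleton] at hi
  rw [map_pow, map_pow]
  exact pow_lt_pow_right₀ h1 (Nat.pow_lt_pow_right one_lt_two (by omega))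

omit [IsScalarTower k (RatFunc k) L] in
theorem ne_zero : y ≠ 0 := by
  rintro rfl
  simpa using one_lt_valuation hQ hy

omit [IsScalarTower k (RatFunc k) L] in
theorem valuation_uniformizer_pow : Q.ring.valuation (uniformizer k y) ^ 2 ^ r =
    (Q.ring.valuation (algebraMap (RatFunc k) L RatFunc.X))⁻¹ := by
  have h0 : Q.ring.valuation (algebraMap (RatFunc k) L RatFunc.X) ≠ 0 :=
    (zero_lt_one.trans (one_lt_valuation_X hQ)).ne'
  rw [uniformizer, map_div₀, map_pow, div_pow, valuation_pow_eq hQ hy, ← pow_mul, pow_succ,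
    div_mul_cancel_left₀ (pow_ne_zero _ h0)]

omit [IsScalarTower k (RatFunc k) L] in
theorem valuation_uniformizer_pos : 0 < Q.ring.valuation (uniformizer k y) := by
  refine zero_lt_iff.2 ((Valuation.ne_zero_iff _).2 (div_ne_zero (pow_ne_zero _ ?_) (ne_zero hQ hy)))
  simpa using RatFunc.X_ne_zero

omit [IsScalarTower k (RatFunc k) L] in
theorem valuation_uniformizer_lt_one : Q.ring.valuation (uniformizer k y) < 1 := by
  by_contra! h
  have h1 := one_le_pow₀ h (n := 2 ^ r)
  rw [valuation_uniformizer_pow hQ hy] at h1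
  exact h1.not_gt (inv_lt_one_of_one_lt₀ (one_lt_valuation_X hQ))

omit [IsScalarTower k (RatFunc k) L] in
theorem valuation_X_eq : Q.ring.valuation (algebraMap (RatFunc k) L RatFunc.X) =
    Q.ring.valuation (uniformizer k y) ^ (-(2 ^ r : ℕ) : ℤ) := by
  rw [zpow_neg, zpow_natCast, valuation_uniformizer_pow hQ hy, inv_inv]

omit [IsScalarTower k (RatFunc k) L] in
theorem valuation_eq : Q.ring.valuation y =
    Q.ring.valuation (uniformizer k y) ^ (-(2 * (2 ^ r : ℕ) + 1) : ℤ) := by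
  have ht := (valuation_uniformizer_pos hQ hy).ne'
  have h : Q.ring.valuation y * Q.ring.valuation (uniformizer k y) =
      Q.ring.valuation (algebraMap (RatFunc k) L RatFunc.X) ^ 2 := by
    rw [← map_mul, ← map_pow, uniformizer, mul_div_cancel₀ _ (ne_zero hQ hy)]
  rw [valuation_X_eq hQ hy, ← zpow_natCast, ← zpow_mul] at h
  rw [eq_div_of_mul_eq ht h, div_eq_mul_inv, ← zpow_neg_one, ← zpow_add₀ ht]
  congr 1
  push_cast
  ring

theorem valuation_monomial {f : RatFunc k} (hf : f ≠ 0) (j : ℕ) :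
    Q.ring.valuation (algebraMap (RatFunc k) L f * y ^ j) =
      Q.ring.valuation (uniformizer k y) ^
        (-((2 ^ r : ℕ) * f.intDegree + (2 * (2 ^ r : ℕ) + 1) * j) : ℤ) := by
  have ht := (valuation_uniformizer_pos hQ hy).ne'
  rw [map_mul, map_pow, valuation_algebraMap hQ hf, valuation_X_eq hQ hy, valuation_eq hQ hy,
    ← zpow_natCast, ← zpow_mul, ← zpow_mul, ← zpow_add₀ ht]
  congr 1
  ring

theorem exists_valuation_aeval_eq {p : (RatFunc k)[X]} (hp : p.natDegree < 2 ^ r) :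
    ∃ j < 2 ^ r,
      Q.ring.valuation (aeval y p) =
        Q.ring.valuation (algebraMap (RatFunc k) L (p.coeff j) * y ^ j) ∧
      ∀ i, Q.ring.valuation (algebraMap (RatFunc k) L (p.coeff i) * y ^ i) ≤
        Q.ring.valuation (aeval y p) := by
  have ht : ∀ {i j : ℤ}, Q.ring.valuation (uniformizer k y) ^ i =
      Q.ring.valuation (uniformizer k y) ^ j → i = j := fun h =>
    zpow_right_injective₀ (valuation_uniformizer_pos hQ hy)
      (valuation_uniformizer_lt_one hQ hy).ne h
  obtain ⟨j, hj, hj1, hj2⟩ := exists_valuation_sum_eq Q.ring.valuation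
    (s := Finset.range (2 ^ r)) ⟨0, by simp⟩
    (fun i => algebraMap (RatFunc k) L (p.coeff i) * y ^ i) (fun i hi j hj h0 h => by
      have hi0 : p.coeff i ≠ 0 := fun h => by simp [h] at h0
      have hj0 : p.coeff j ≠ 0 := fun h' => by simp [h, h'] at h0
      rw [valuation_monomial hQ hy hi0, valuation_monomial hQ hy hj0] at h
      exact (order_injective (Finset.mem_range.1 hi) (Finset.mem_range.1 hj)
        (neg_inj.1 (ht h))).1)
  have hsum : aeval y p =
      ∑ i ∈ Finset.range (2 ^ r), algebraMap (RatFunc k) L (p.coeff i) * y ^ i := by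
    rw [aeval_eq_sum_range' hp]
    simp_rw [Algebra.smul_def]
  rw [hsum]
  refine ⟨j, Finset.mem_range.1 hj, hj1, fun i => ?_⟩
  rw [hj1]
  by_cases hi : i < 2 ^ r
  · exact hj2 i (Finset.mem_range.2 hi)
  · rw [coeff_eq_zero_of_natDegree_lt (by omega)]
    simp

theorem isUniformizer : Q.IsUniformizer (uniformizer k y) := by
  refine ⟨valuation_uniformizer_pos hQ hy, valuation_uniformizer_lt_one hQ hy, fun z hz => ?_⟩
  obtain ⟨p, hp, rfl⟩ := hy.exists_aeval_eq z
  obtain ⟨j, -, hj, -⟩ := exists_valuation_aeval_eq hQ hy hp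
  have h0 : p.coeff j ≠ 0 := fun h => by simp [h] at hj; exact hz hj
  exact ⟨_, hj.trans (valuation_monomial hQ hy h0 j)⟩

theorem aeval_mem_iff {p : (RatFunc k)[X]} (hp : p.natDegree < 2 ^ r) :
    aeval y p ∈ Q.ring ↔ ∀ j, p.coeff j = 0 ∨
      ((2 ^ r : ℕ) * (p.coeff j).intDegree + (2 * (2 ^ r : ℕ) + 1) * j : ℤ) ≤ 0 := by
  have ht := isUniformizer hQ hy
  have key (j : ℕ) : Q.ring.valuation (algebraMap (RatFunc k) L (p.coeff j) * y ^ j) ≤ 1 ↔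
      p.coeff j = 0 ∨
        ((2 ^ r : ℕ) * (p.coeff j).intDegree + (2 * (2 ^ r : ℕ) + 1) * j : ℤ) ≤ 0 := by
    by_cases h0 : p.coeff j = 0
    · simp [h0]
    · rw [valuation_monomial hQ hy h0, ← zpow_zero (Q.ring.valuation (uniformizer k y)),
        ht.zpow_le_iff, neg_nonneg, or_iff_right h0]
  simp_rw [← key]
  obtain ⟨j, -, hj, hle⟩ := exists_valuation_aeval_eq hQ hy hp
  rw [← Q.ring.valuation_le_one_iff]
  exact ⟨fun h i => (hle i).trans h, fun h => hj ▸ h j⟩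

theorem eq_of_liesOver {Q' : Place k L} (hQ' : Q'.LiesOver (inftyPlace k)) : Q' = Q := by
  refine Place.ext_ring (ValuationSubring.ext _ _ fun z => ?_)
  obtain ⟨p, hp, rfl⟩ := hy.exists_aeval_eq z
  rw [aeval_mem_iff hQ hy hp, aeval_mem_iff hQ' hy hp]

end Place

variable (hy : IsAbdonTorres k (r + 1) y)

include hy

/-- Total ramification at infinity forces the defining polynomial to be irreducible. -/
theorem minpoly_eq : minpoly (RatFunc k) y = definingPolynomial k (r + 1) := by
  obtain ⟨Q, hQ⟩ := Place.exists_liesOver (E := L) (inftyPlace k)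
  symm
  refine minpoly.unique _ _ (monic_definingPolynomial k r) hy.aeval_definingPolynomial
    fun p hp hpy => ?_
  rw [degree_eq_natDegree hp.ne_zero, degree_eq_natDegree (monic_definingPolynomial k r).ne_zero,
    natDegree_definingPolynomial, Nat.cast_le]
  by_contra! hlt
  obtain ⟨-, -, -, hle⟩ := exists_valuation_aeval_eq hQ hy hlt
  have := hle p.natDegree
  rw [hpy, map_zero, valuation_monomial hQ hy (by simpa using hp.ne_zero)] at this
  exact this.not_gt (zpow_pos (valuation_uniformizer_pos hQ hy) _)

end Infinity

end IsAbdonTorres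

end FunctionFieldPlaces

/-! ### Ramification groups, different and conductor -/

namespace FunctionFieldPlaces

namespace IsAbdonTorres

section Conductor

variable {k : Type*} [Field k] {L : Type*} [Field L] [Algebra k L] [Algebra (RatFunc k) L]
  [IsScalarTower k (RatFunc k) L] {r : ℕ} {y : L}

variable (hy : IsAbdonTorres k (r + 1) y)

section Ramification

variable [Finite k] [CharP k 2] (hk : Nat.card k = (2 ^ (r + 1)) ^ 2) {Q : Place k L}
  (hQ : Q.LiesOver (inftyPlace k))

include hy hk hQ

/-- Every automorphism `y ↦ y + a` changes an integral element by an element of order at least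
`q + 2`. Writing the integral element as `∑ f_j y^j`, the terms with `j > 0` have order
at least `1` (their orders are not divisible by `q / 2`), and `(y + a)^j - y^j` has order at least
`ν(y^j) + q + 1`. -/
theorem valuation_apply_sub_le (σ : L ≃ₐ[RatFunc k] L) {z : L} (hz : z ∈ Q.ring) :
    Q.ring.valuation (σ z - z) ≤
      Q.ring.valuation (uniformizer k y) ^ (2 * (2 ^ r : ℕ) + 2 : ℤ) := by
  have ht := isUniformizer hQ hy
  obtain ⟨a, ha⟩ := hy.exists_apply_eq hk σ
  obtain ⟨p, hp, rfl⟩ := hy.exists_aeval_eq z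
  have hint := (aeval_mem_iff hQ hy hp).1 hz
  have hy1 := one_lt_valuation hQ hy
  have hya : Q.ring.valuation (y + algebraMap k L a) ≤ Q.ring.valuation y :=
    (Q.ring.valuation.map_add _ _).trans (max_le le_rfl
      (((Q.ring.valuation_le_one_iff _).2 (Q.algebraMap_mem a)).trans hy1.le))
  rw [aeval_eq_sum_range' hp, map_sum, ← Finset.sum_sub_distrib]
  refine Q.ring.valuation.map_sum_le fun j hj => ?_
  rw [map_smul, map_pow, ha, ← smul_sub, Algebra.smul_def]
  by_cases h0 : p.coeff j = 0
  · rw [h0, map_zero, zero_mul, map_zero]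
    exact zero_le
  by_cases hj0 : j = 0
  · rw [hj0, pow_zero, pow_zero, sub_self, mul_zero, map_zero]
    exact zero_le
  obtain ⟨i, rfl⟩ := Nat.exists_eq_succ_of_ne_zero hj0
  have hpow : Q.ring.valuation ((y + algebraMap k L a) ^ i.succ - y ^ i.succ) ≤
      Q.ring.valuation (y ^ i) := by
    rw [← geom_sum₂_mul, add_sub_cancel_left, map_mul]
    refine (mul_le_of_le_one_right' ((Q.ring.valuation_le_one_iff _).2
      (Q.algebraMap_mem a))).trans ?_
    refine Q.ring.valuation.map_sum_le fun l hl => ?_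
    have hl : l ≤ i := Nat.lt_succ_iff.1 (Finset.mem_range.1 hl)
    rw [map_mul, map_pow, map_pow, map_pow]
    calc _ ≤ Q.ring.valuation y ^ l * Q.ring.valuation y ^ (i.succ - 1 - l) := by gcongr
      _ = Q.ring.valuation y ^ i := by rw [← pow_add]; congr 1; omega
  have hmul : Q.ring.valuation (algebraMap (RatFunc k) L (p.coeff i.succ) *
      ((y + algebraMap k L a) ^ i.succ - y ^ i.succ)) ≤
      Q.ring.valuation (algebraMap (RatFunc k) L (p.coeff i.succ) * y ^ i) := by
    rw [map_mul, map_mul]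
    gcongr
  refine hmul.trans ?_
  rw [valuation_monomial hQ hy h0, ht.zpow_le_iff]
  have h1 := (hint i.succ).resolve_left h0
  have h2 : i.succ < 2 ^ r := Finset.mem_range.1 hj
  generalize (2 ^ r : ℕ) = m at *
  generalize (p.coeff i.succ).intDegree = d at *
  -- The order of `f_j y^j` is nonzero, because it is congruent to `-j` modulo `q / 2`.
  have h3 : (m * d + (2 * m + 1) * (i.succ : ℕ) : ℤ) ≠ 0 := fun h => by
    have := (order_injective (m := m) (i := i.succ) (j := 0) (a := d) (b := 0) h2 (by omega)
      (by simpa using h)).1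
    exact hj0 this
  have h4 := lt_of_le_of_ne h1 h3
  push_cast at h4
  linarith

theorem valuation_apply_uniformizer_sub {σ : L ≃ₐ[RatFunc k] L} (hσ : σ ≠ 1) :
    Q.ring.valuation (σ (uniformizer k y) - uniformizer k y) =
      Q.ring.valuation (uniformizer k y) ^ (2 * (2 ^ r : ℕ) + 2 : ℤ) := by
  have ht := isUniformizer hQ hy
  obtain ⟨a, ha⟩ := hy.exists_apply_eq hk σ
  have ha0 : a ≠ 0 := by
    rintro rfl
    exact hσ (hy.algEquiv_ext (by simpa using ha))
  have hy0 := ne_zero hQ hy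
  have hy1 := one_lt_valuation hQ hy
  have hva := Q.valuation_algebraMap ha0
  have hya : Q.ring.valuation (y + algebraMap k L a) = Q.ring.valuation y :=
    Q.ring.valuation.map_add_eq_of_lt_left (hva ▸ hy1)
  have hya0 : y + algebraMap k L a ≠ 0 := by
    rw [← Valuation.ne_zero_iff Q.ring.valuation, hya]
    exact (zero_lt_one.trans hy1).ne'
  have h : σ (uniformizer k y) - uniformizer k y =
      -(algebraMap k L a * algebraMap (RatFunc k) L RatFunc.X ^ 2 /
        ((y + algebraMap k L a) * y)) := by
    rw [uniformizer, map_div₀, map_pow, σ.commutes, ha]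
    field_simp
    ring
  rw [h, Valuation.map_neg, map_div₀, map_mul, map_mul, hva, hya, one_mul, map_pow,
    valuation_X_eq hQ hy, valuation_eq hQ hy, ← zpow_natCast, ← zpow_mul,
    ← zpow_add₀ ht.pos.ne', ← zpow_sub₀ ht.pos.ne']
  congr 1
  push_cast
  ring

theorem ramificationGroup_eq_univ {j : ℕ} (hj : j ≤ 2 * 2 ^ r + 1) :
    Q.ramificationGroup (RatFunc k) j = Set.univ := by
  have ht := isUniformizer hQ hy
  refine Set.eq_univ_of_forall fun σ z hz => ?_
  rw [ht.le_nu_iff]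
  refine (valuation_apply_sub_le hy hk hQ σ hz).trans (ht.zpow_le_iff.2 ?_)
  push_cast
  exact_mod_cast Nat.succ_le_succ hj

theorem ramificationGroup_eq_one {j : ℕ} (hj : 2 * 2 ^ r + 2 ≤ j) :
    Q.ramificationGroup (RatFunc k) j = {1} := by
  have ht := isUniformizer hQ hy
  ext σ
  rw [Set.mem_singleton_iff]
  constructor
  · intro h
    by_contra hσ
    have h1 := h _ ht.mem
    rw [ht.le_nu_iff, valuation_apply_uniformizer_sub hy hk hQ hσ, ht.zpow_le_iff] at h1
    have : ((2 * 2 ^ r + 2 : ℕ) : ℤ) ≤ j := by exact_mod_cast hj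
    push_cast at this h1
    linarith
  · rintro rfl z -
    simp [Place.nu_zero]

theorem ramificationBound_eq (hr : r ≠ 0) :
    Q.ramificationBound (RatFunc k) = 2 * 2 ^ r + 2 := by
  have := hy.isGalois hk
  have := hy.finiteDimensional
  have hcard : Nat.card (L ≃ₐ[RatFunc k] L) = 2 ^ r := by
    rw [IsGalois.card_aut_eq_finrank,
      (PowerBasis.ofAdjoinEqTop hy.isIntegral hy.algebra_adjoin_eq_top).finrank,
      PowerBasis.ofAdjoinEqTop_dim, hy.minpoly_eq, natDegree_definingPolynomial]
  refine le_antisymm (Nat.sInf_le fun j hj => ramificationGroup_eq_one hy hk hQ hj) ?_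
  refine le_csInf ⟨_, fun j hj => ramificationGroup_eq_one hy hk hQ hj⟩ fun a ha => ?_
  by_contra! hlt
  -- Otherwise the last nontrivial ramification group would be both everything and trivial.
  have h1 := ha (2 * 2 ^ r + 1) (by omega)
  rw [ramificationGroup_eq_univ hy hk hQ le_rfl] at h1
  have : Subsingleton (L ≃ₐ[RatFunc k] L) :=
    Set.subsingleton_univ_iff.1 (h1 ▸ Set.subsingleton_singleton)
  rw [Nat.card_of_subsingleton 1] at hcard
  exact (Nat.one_lt_two_pow hr).ne hcard

end Ramification

theorem ramificationIndex_eq {Q : Place k L} (hQ : Q.LiesOver (inftyPlace k))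
    (hy : IsAbdonTorres k (r + 1) y) : Q.ramificationIndex (inftyPlace k) = 2 ^ r := by
  refine hQ.ramificationIndex_eq isPrimeElement_inftyPlace (isUniformizer hQ hy) ?_
  rw [map_inv₀, map_inv₀, valuation_uniformizer_pow hQ hy]

include hy in
theorem aeval_derivative_minpoly [CharP k 2] :
    aeval y (derivative (minpoly (RatFunc k) y)) = 1 := by
  have := charP_ratFunc (k := k)
  rw [hy.minpoly_eq, derivative_definingPolynomial, map_one]

include hy in
/-- Dividing `y^{q/2} + ⋯ + y = x^{q+1}` by a suitable power of `x` gives an Eisenstein equation for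
`t = x² / y`, namely `t^{q/2} = ∑ x^{2^{i+1} - q - 1} t^{q/2 - 2^i}`. -/
theorem isIntegral_uniformizer : IsIntegral (inftyPlace k).ring (uniformizer k y) := by
  obtain ⟨Q, hQ⟩ := Place.exists_liesOver (E := L) (inftyPlace k)
  have hy0 := ne_zero hQ hy
  set x := algebraMap (RatFunc k) L RatFunc.X with hx
  have hx0 : x ≠ 0 := by simpa [hx] using RatFunc.X_ne_zero
  set s : (inftyPlace k).ring := ⟨RatFunc.X⁻¹, isUniformizer_inftyPlace.mem⟩ with hs
  have hs' : algebraMap (inftyPlace k).ring L s = x⁻¹ := by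
    change algebraMap (RatFunc k) L RatFunc.X⁻¹ = _
    rw [map_inv₀]
  set g : ((inftyPlace k).ring)[X] :=
    ∑ i ∈ Finset.range (r + 1), C (s ^ (2 * 2 ^ r + 1 - 2 * 2 ^ i)) * X ^ (2 ^ r - 2 ^ i) with hg
  have hle {i : ℕ} (hi : i ∈ Finset.range (r + 1)) : 2 ^ i ≤ 2 ^ r :=
    Nat.pow_le_pow_right two_pos (Nat.lt_succ_iff.1 (Finset.mem_range.1 hi))
  have hdeg : g.degree < ((2 ^ r : ℕ) : WithBot ℕ) := by
    rw [← mem_degreeLT]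
    refine Submodule.sum_mem _ fun i hi => mem_degreeLT.2 ((degree_C_mul_X_pow_le _ _).trans_lt ?_)
    have h1 := hle hi
    have h2 := Nat.two_pow_pos i
    exact_mod_cast (by omega : 2 ^ r - 2 ^ i < 2 ^ r)
  refine ⟨X ^ 2 ^ r - g, monic_X_pow_sub hdeg, ?_⟩
  rw [← aeval_def, map_sub, sub_eq_zero, hg, map_sum, map_pow, aeval_X]
  have hterm (i : ℕ) (hi : i ∈ Finset.range (r + 1)) :
      aeval (uniformizer k y) (C (s ^ (2 * 2 ^ r + 1 - 2 * 2 ^ i)) * X ^ (2 ^ r - 2 ^ i)) =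
        uniformizer k y ^ 2 ^ r / x ^ (2 * 2 ^ r + 1) * y ^ 2 ^ i := by
    have h1 := hle hi
    rw [map_mul, aeval_C, map_pow, map_pow, aeval_X, hs']
    obtain ⟨b, hb⟩ := Nat.exists_eq_add_of_le h1
    rw [hb, Nat.add_sub_cancel_left, show 2 * (2 ^ i + b) + 1 - 2 * 2 ^ i = 2 * b + 1 by omega,
      uniformizer, ← hx]
    generalize 2 ^ i = c
    rw [inv_pow, div_pow, div_pow]
    field_simp
    ring
  rw [Finset.sum_congr rfl hterm, ← Finset.mul_sum, hy.equation, pow_succ' 2 r,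
    div_mul_cancel₀ _ (pow_ne_zero _ hx0)]

section DifferentExponent

variable [Finite k] [CharP k 2] (hk : Nat.card k = (2 ^ (r + 1)) ^ 2) {Q : Place k L}

include hy hk

theorem trace_aeval {p : (RatFunc k)[X]} (hp : p.natDegree < 2 ^ r) :
    Algebra.trace (RatFunc k) L (aeval y p) = p.coeff (2 ^ r - 1) := by
  have := hy.isGalois hk
  have := hy.finiteDimensional
  have h := natDegree_definingPolynomial k r
  rw [← hy.minpoly_eq] at h
  rw [Place.trace_aeval_eq_coeff hy.algebra_adjoin_eq_top hy.aeval_derivative_minpoly (h ▸ hp), h]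

theorem mem_complementaryModule (hQ : Q.LiesOver (inftyPlace k)) {z : L}
    (hz : Q.ring.valuation z ≤ Q.ring.valuation (uniformizer k y) ^
      (-(((2 ^ r : ℕ) - 1) * (2 * (2 ^ r : ℕ) + 2)) : ℤ)) :
    z ∈ (inftyPlace k).complementaryModule L := by
  intro w hw
  have ht := isUniformizer hQ hy
  have hw1 : Q.ring.valuation w ≤ 1 := (Q.ring.valuation_le_one_iff _).2
    (hQ.mem_of_isIntegral hw)
  obtain ⟨p, hp, hpz⟩ := hy.exists_aeval_eq (z * w)
  rw [← hpz, trace_aeval hy hk hp, mem_inftyPlace, or_iff_not_imp_left]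
  intro h0
  obtain ⟨-, -, -, hle⟩ := exists_valuation_aeval_eq hQ hy hp
  have h1 := hle (2 ^ r - 1)
  rw [hpz, Q.ring.valuation.map_mul z w] at h1
  replace h1 := (h1.trans (mul_le_of_le_one_right' hw1)).trans hz
  rw [valuation_monomial hQ hy h0, ht.zpow_le_iff] at h1
  have hm := Nat.two_pow_pos r
  generalize (2 ^ r : ℕ) = m at *
  push_cast [Nat.cast_sub (show 1 ≤ m from hm)] at h1
  have h2 : (m : ℤ) * (p.coeff (m - 1)).intDegree < m * 1 := by nlinarith
  have := lt_of_mul_lt_mul_left h2 (by omega)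
  omega

/-- If `z` has order less than `-(q/2 - 1)(q + 2)`, then for a suitable `s` the element `z t^s` has
the order of `x y^{q/2 - 1}`, hence a trace of degree `1`. -/
theorem notMem_complementaryModule (hQ : Q.LiesOver (inftyPlace k)) {z : L} {i : ℤ}
    (hz : Q.ring.valuation z = Q.ring.valuation (uniformizer k y) ^ i)
    (hi : i < -(((2 ^ r : ℕ) - 1) * (2 * (2 ^ r : ℕ) + 2) : ℤ)) :
    z ∉ (inftyPlace k).complementaryModule L := by
  intro hmem
  have ht := isUniformizer hQ hy
  obtain ⟨s, hs⟩ : ∃ s : ℕ, (s : ℤ) = -(((2 ^ r : ℕ) - 1) * (2 * (2 ^ r : ℕ) + 2) : ℤ) - 1 - i :=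
    ⟨_, Int.toNat_of_nonneg (by omega)⟩
  have htr := hmem (uniformizer k y ^ s) (hy.isIntegral_uniformizer.pow s)
  obtain ⟨p, hp, hpz⟩ := hy.exists_aeval_eq (z * uniformizer k y ^ s)
  rw [← hpz, trace_aeval hy hk hp, mem_inftyPlace] at htr
  obtain ⟨j, hjm, hj, -⟩ := exists_valuation_aeval_eq hQ hy hp
  have hval : Q.ring.valuation (aeval y p) = Q.ring.valuation (uniformizer k y) ^ (i + s) := by
    rw [hpz, map_mul, map_pow, hz, zpow_add₀ ht.pos.ne', zpow_natCast]
  have h0 : p.coeff j ≠ 0 := fun h => by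
    rw [h, map_zero, zero_mul, map_zero, hval] at hj
    exact (zpow_pos ht.pos _).ne' hj
  rw [hval, valuation_monomial hQ hy h0, ht.zpow_inj] at hj
  have hm := Nat.two_pow_pos r
  generalize (2 ^ r : ℕ) = m at *
  obtain ⟨rfl, hdeg⟩ := order_injective (m := m) (i := j) (j := m - 1) (b := 1) hjm (by omega) (by
    push_cast [Nat.cast_sub (show 1 ≤ m from hm)]
    linarith)
  rcases htr with h | h
  · exact h0 h
  · omega

theorem differentExponent_inftyPlace (hQ : Q.LiesOver (inftyPlace k)) :
    Q.differentExponent (inftyPlace k) = ((2 ^ r : ℕ) - 1) * (2 * (2 ^ r : ℕ) + 2) := by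
  have ht := isUniformizer hQ hy
  refine IsGreatest.csSup_eq ⟨?_, ?_⟩
  · have hval := map_zpow₀ Q.ring.valuation (uniformizer k y)
      (-(((2 ^ r : ℕ) - 1) * (2 * (2 ^ r : ℕ) + 2)))
    exact ⟨_, mem_complementaryModule hy hk hQ hval.le, ht.nu_eq hval⟩
  · rintro d ⟨z, hz, hzd⟩
    have hz0 : z ≠ 0 := by
      rintro rfl
      rw [Place.nu_zero] at hzd
      exact WithTop.top_ne_coe hzd
    obtain ⟨i, hi⟩ := ht.exists_zpow z hz0
    have hid : i = -d := by
      rw [ht.nu_eq hi] at hzd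
      exact_mod_cast hzd
    by_contra! hlt
    exact notMem_complementaryModule hy hk hQ hi (by omega) hz

theorem conductorExponent_inftyPlace (hr : r ≠ 0) (hQ : Q.LiesOver (inftyPlace k)) :
    Q.conductorExponent (inftyPlace k) = 2 ^ (r + 1) + 2 := by
  rw [Place.conductorExponent, differentExponent_inftyPlace hy hk hQ,
    ramificationBound_eq hy hk hQ hr, ramificationIndex_eq hQ hy]
  push_cast
  field_simp
  ring

end DifferentExponent

section FinitePlaces

variable {P : Place k (RatFunc k)} {Q : Place k L}

include hy

omit [Algebra k L] [IsScalarTower k (RatFunc k) L] in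
theorem isIntegral_of_ne_inftyPlace (hP : P ≠ inftyPlace k) : IsIntegral P.ring y := by
  set s : P.ring := ⟨RatFunc.X, X_mem_of_ne_inftyPlace hP⟩
  refine ⟨X ^ 2 ^ r + (tracePolynomial P.ring r - C (s ^ (2 ^ (r + 1) + 1))),
    monic_X_pow_add ?_, ?_⟩
  · exact (degree_sub_le _ _).trans_lt (max_lt (degree_tracePolynomial_lt r)
      (degree_C_le.trans_lt (by exact_mod_cast Nat.two_pow_pos r)))
  · rw [← add_sub_assoc, ← tracePolynomial_succ, eval₂_eq_eval_map, Polynomial.map_sub,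
      map_tracePolynomial, eval_sub, hy.eval_tracePolynomial_eq, map_C, eval_C, map_pow]
    exact sub_self _

variable [Finite k] [CharP k 2] (hk : Nat.card k = (2 ^ (r + 1)) ^ 2) (hP : P ≠ inftyPlace k)
  (hQ : Q.LiesOver P)

include hk hP hQ

theorem differentExponent_eq_zero : Q.differentExponent P = 0 := by
  have := hy.isGalois hk
  have := hy.finiteDimensional
  have hint := hy.isIntegral_of_ne_inftyPlace hP
  refine IsGreatest.csSup_eq ⟨⟨1, fun w hw => ?_, ?_⟩, ?_⟩
  · rw [one_mul]
    obtain ⟨a, ha⟩ := IsIntegrallyClosed.isIntegral_iff.1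
      (Algebra.isIntegral_trace (R := P.ring) (L := RatFunc k) hw)
    exact ha ▸ a.2
  · exact Q.nu_eq_zero (map_one _)
  · rintro d ⟨z, hz, hzd⟩
    have h := Place.isIntegral_mul_of_mem_complementaryModule hint hy.algebra_adjoin_eq_top hz
    rw [hy.aeval_derivative_minpoly, mul_one] at h
    have h2 := Q.nu_nonneg (hQ.mem_of_isIntegral h)
    rw [hzd] at h2
    have : (0 : ℤ) ≤ -d := by exact_mod_cast h2
    omega

omit [IsScalarTower k (RatFunc k) L] in
/-- A nontrivial automorphism moves the integral element `y` by a nonzero constant. -/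
theorem ramificationBound_eq_zero : Q.ramificationBound (RatFunc k) = 0 := by
  refine Nat.eq_zero_of_le_zero (Nat.sInf_le fun j _ => ?_)
  ext σ
  rw [Set.mem_singleton_iff]
  constructor
  · intro h
    by_contra hσ
    obtain ⟨a, ha⟩ := hy.exists_apply_eq hk σ
    have ha0 : a ≠ 0 := by
      rintro rfl
      exact hσ (hy.algEquiv_ext (by simpa using ha))
    have h1 := h y (hQ.mem_of_isIntegral (hy.isIntegral_of_ne_inftyPlace hP))
    rw [ha, add_sub_cancel_left, Q.nu_eq_zero (Q.valuation_algebraMap ha0)] at h1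
    have : (j : ℤ) + 1 ≤ 0 := by exact_mod_cast h1
    omega
  · rintro rfl z -
    simp [Place.nu_zero]

theorem conductorExponent_eq_zero : Q.conductorExponent P = 0 := by
  rw [Place.conductorExponent, differentExponent_eq_zero hy hk hP hQ,
    ramificationBound_eq_zero hy hk hP hQ]
  simp

end FinitePlaces

end Conductor

end IsAbdonTorres

end FunctionFieldPlaces

open FunctionFieldPlaces in
theorem proposition4p2 (n q : ℕ) (hq : q = 2 ^ n) (hq4 : 4 ≤ q)
    (k : Type*) [Field k] [Finite k] (hk : Nat.card k = q ^ 2)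
    (L : Type*) [Field L] [Algebra k L] [Algebra (RatFunc k) L] [IsScalarTower k (RatFunc k) L]
    (y : L) (hL : IsAbdonTorres k n y) :
    -- the extension is finite abelian
    FiniteDimensional (RatFunc k) L ∧ IsAbelianGalois (RatFunc k) L ∧
    -- its conductor is `(q + 2) ∞`
    IsConductor L (Finsupp.single (inftyPlace k) ((q : ℤ) + 2)) ∧
    -- the ramification groups at the unique place over `∞`
    ∃ Pinf : Place k L, (∀ Q : Place k L, Q.LiesOver (inftyPlace k) ↔ Q = Pinf) ∧
      (∀ j : ℕ, j ≤ q + 1 → Pinf.ramificationGroup (RatFunc k) j = Set.univ) ∧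
      (∀ j : ℕ, q + 2 ≤ j → Pinf.ramificationGroup (RatFunc k) j = {1}) := by
  subst hq
  obtain ⟨r, rfl⟩ : ∃ r, n = r + 1 := Nat.exists_eq_succ_of_ne_zero (by rintro rfl; omega)
  have hr : r ≠ 0 := by rintro rfl; omega
  have : CharP k 2 := by
    have h0 : ((Nat.card k : ℕ) : k) = 0 := by
      have := Fintype.ofFinite k
      rw [Nat.card_eq_fintype_card, Nat.cast_card_eq_zero]
    rw [hk, Nat.cast_pow, Nat.cast_pow] at h0
    exact CharTwo.of_one_ne_zero_of_two_eq_zero one_ne_zero (by simpa using h0)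
  have hpow : 2 ^ (r + 1) = 2 * 2 ^ r := pow_succ' 2 r
  obtain ⟨Pinf, hPinf⟩ := Place.exists_liesOver (E := L) (inftyPlace k)
  refine ⟨hL.finiteDimensional, hL.isAbelianGalois hk, fun P => ⟨P.exists_liesOver, fun Q hQ => ?_⟩,
    Pinf, fun Q => ⟨fun hQ => IsAbdonTorres.eq_of_liesOver hPinf hL hQ, fun h => h ▸ hPinf⟩,
    fun j hj => hL.ramificationGroup_eq_univ hk hPinf (by omega),
    fun j hj => hL.ramificationGroup_eq_one hk hPinf (by omega)⟩
  by_cases hP : P = inftyPlace k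
  · subst hP
    rw [Finsupp.single_eq_same, hL.conductorExponent_inftyPlace hk hr hQ]
    push_cast
    rfl
  · rw [Finsupp.single_eq_of_ne hP, hL.conductorExponent_eq_zero hk hP hQ, Int.cast_zero]
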